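/- Let $\Gamma$ be a finite set with $N=\operatorname{card}(\Gamma)>1$ elements. The Dyck inverse monoid of $\Gamma$ is the monoid with zero generated by symbols $\gamma(-),\gamma(+)$ $(\gamma\in\Gamma)$ subject to the relations $\gamma(-)\gamma(+)=\mathbf 1$ and $\gamma(-)\gamma'(+)=0$ for $\gamma\neq\gamma'$. The Dyck shift $D_N$ is the set of bi-infinite sequences over the alphabet $\{\gamma(-),\gamma(+):\gamma\in\Gamma\}$ all of whose finite subwords have a nonzero product in this monoid. Let $1\le K<N$, let $\Psi$ be a map that assigns to every $\gamma\in\Gamma$ a subset $\Psi(\gamma)\subset\Gamma$ with $\operatorname{card}(\Psi(\gamma))=K$, and let $X_\Psi$ be the subshift of those points of $D_N$ in which no word $\beta(+)\alpha(+)$ with $\alpha,\beta\in\Gamma$, $\beta\notin\Psi(\alpha)$, appears. For $n\in\mathbb N$ let $\mathcal L_n(X_\Psi)$ be the set of words of length $n$ that appear in points of $X_\Psi$. Then the topological entropy $h(X_\Psi)=\lim_{n\to\infty}\frac1n\log\operatorname{card}(\mathcal L_n(X_\Psi))$ exists and $$h(X_\Psi)=\log N+\log(N-K)+\log 2-\log\left(\sqrt{(N^2+K)^2+4(N-K)N^2}-N^2-K\right).$$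 -/

import Mathlib

open Filter Topology SymbolicDynamics.FullShift

noncomputable section

/-- The alphabet `{γ(-), γ(+) : γ ∈ Γ}` of the Dyck shift: `minus γ` is `γ(-)` and `plus γ` is
`γ(+)`. -/
inductive DyckSymbol (Γ : Type*) where
  | minus (γ : Γ) : DyckSymbol Γ
  | plus (γ : Γ) : DyckSymbol Γ

instance (Γ : Type*) : TopologicalSpace (DyckSymbol Γ) := ⊥

instance (Γ : Type*) : DiscreteTopology (DyckSymbol Γ) := ⟨rfl⟩

/-- The relations `γ(-) γ(+) = 1` and `γ(-) γ'(+) = 0` for `γ ≠ γ'`, between elements of the free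
monoid with zero on the symbols `γ(-), γ(+)`. -/
inductive DyckRel (Γ : Type*) :
    WithZero (FreeMonoid (DyckSymbol Γ)) → WithZero (FreeMonoid (DyckSymbol Γ)) → Prop where
  | eq_one (γ : Γ) : DyckRel Γ
      (((FreeMonoid.of (DyckSymbol.minus γ) * FreeMonoid.of (DyckSymbol.plus γ) :
        FreeMonoid (DyckSymbol Γ))) : WithZero (FreeMonoid (DyckSymbol Γ))) 1
  | eq_zero (γ γ' : Γ) (h : γ ≠ γ') : DyckRel Γ
      (((FreeMonoid.of (DyckSymbol.minus γ) * FreeMonoid.of (DyckSymbol.plus γ') :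
        FreeMonoid (DyckSymbol Γ))) : WithZero (FreeMonoid (DyckSymbol Γ))) 0

/-- The Dyck inverse monoid (polycyclic monoid) on `Γ`: the monoid with zero that is generated by
`γ(-), γ(+)`, `γ ∈ Γ`, subject to the relations `DyckRel`. -/
def DyckInverseMonoid (Γ : Type*) : Type _ := (conGen (DyckRel Γ)).Quotient

namespace DyckInverseMonoid

instance (Γ : Type*) : Monoid (DyckInverseMonoid Γ) :=
  inferInstanceAs (Monoid (conGen (DyckRel Γ)).Quotient)

/-- The quotient map from the free monoid with zero. -/
def mk (Γ : Type*) : WithZero (FreeMonoid (DyckSymbol Γ)) →* DyckInverseMonoid Γ :=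
  (conGen (DyckRel Γ)).mk'

instance (Γ : Type*) : MonoidWithZero (DyckInverseMonoid Γ) where
  zero := mk Γ 0
  zero_mul a := by
    obtain ⟨b, rfl⟩ := Con.mk'_surjective (c := conGen (DyckRel Γ)) a
    exact ((mk Γ).map_mul 0 b).symm.trans (congrArg (mk Γ) (zero_mul b))
  mul_zero a := by
    obtain ⟨b, rfl⟩ := Con.mk'_surjective (c := conGen (DyckRel Γ)) a
    exact ((mk Γ).map_mul b 0).symm.trans (congrArg (mk Γ) (mul_zero b))

/-- The generators `γ(-)`, `γ(+)` of the Dyck inverse monoid. -/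
def of {Γ : Type*} (s : DyckSymbol Γ) : DyckInverseMonoid Γ :=
  mk Γ ((FreeMonoid.of s : FreeMonoid (DyckSymbol Γ)) : WithZero (FreeMonoid (DyckSymbol Γ)))

end DyckInverseMonoid

/-- The word `x_i x_{i+1} ... x_{i+n-1}` of length `n` that appears in the point `x` at `i`. -/
def wordAt {A : Type*} (x : ℤ → A) (i : ℤ) (n : ℕ) : List A :=
  List.ofFn fun j : Fin n => x (i + (j : ℤ))

theorem isClosed_setOf_wordAt {A : Type*} [TopologicalSpace A] [DiscreteTopology A]
    (i : ℤ) (n : ℕ) (P : List A → Prop) : IsClosed {x : ℤ → A | P (wordAt x i n)} := by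
  have hc : Continuous fun (x : ℤ → A) (j : Fin n) => x (i + (j : ℤ)) := by fun_prop
  exact (isClosed_discrete {f : Fin n → A | P (List.ofFn f)}).preimage hc

theorem wordAt_shift {A : Type*} (g : ℤ) (x : ℤ → A) (i : ℤ) (n : ℕ) :
    wordAt (shift g x) i n = wordAt x (g + i) n := by
  simp [wordAt, add_assoc]

/-- The set of admissible words of length `n` of a subshift: the words of length `n` that appear
somewhere in a point of the subshift. -/
def languageOfLength {A : Type*} [TopologicalSpace A] (X : Subshift A ℤ) (n : ℕ) : Set (List A) :=
  {w | ∃ x ∈ X.carrier, ∃ i : ℤ, wordAt x i n = w}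

/-- `h` is the topological entropy of the subshift `X` (over a finite alphabet):
the limit of `(1 / n) log card L_n(X)` exists and equals `h`. -/
def HasTopologicalEntropy {A : Type*} [TopologicalSpace A] (X : Subshift A ℤ) (h : ℝ) : Prop :=
  Tendsto (fun n : ℕ => (1 / (n : ℝ)) * Real.log ((languageOfLength X n).ncard : ℝ)) atTop (𝓝 h)

/-- The subshift obtained from `X` by excluding the words in `F`: the points of `X` in which no word
of `F` appears. -/
def excludeWords {A : Type*} [TopologicalSpace A] [DiscreteTopology A] (X : Subshift A ℤ)
    (F : Set (List A)) : Subshift A ℤ where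
  carrier := {x | x ∈ X.carrier ∧ ∀ w ∈ F, ∀ i : ℤ, wordAt x i w.length ≠ w}
  isClosed := by
    refine X.isClosed.inter (s₂ := {x | ∀ w ∈ F, ∀ i : ℤ, wordAt x i w.length ≠ w}) ?_
    simp only [Set.ofPred_forall]
    exact isClosed_iInter fun w => isClosed_iInter fun _ => isClosed_iInter fun i =>
      isClosed_setOf_wordAt i w.length fun v => v ≠ w
  mapsTo g x hx := ⟨X.mapsTo g hx.1, fun w hw i => by
    rw [wordAt_shift]
    exact hx.2 w hw (g + i)⟩

/-- The Dyck shift on `Γ`: the points all of whose finite words have a nonzero product in the Dyck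
inverse monoid. -/
def dyckShift (Γ : Type*) : Subshift (DyckSymbol Γ) ℤ where
  carrier := {x | ∀ (i : ℤ) (n : ℕ), ((wordAt x i n).map DyckInverseMonoid.of).prod ≠ 0}
  isClosed := by
    simp only [Set.ofPred_forall]
    exact isClosed_iInter fun i => isClosed_iInter fun n =>
      isClosed_setOf_wordAt i n fun v => (v.map DyckInverseMonoid.of).prod ≠ 0
  mapsTo g x hx i n := by
    rw [wordAt_shift]
    exact hx (g + i) n

/-- The subshift `X_Ψ` obtained from the Dyck shift by excluding the words `β(+) α(+)` with
`β ∉ Ψ(α)`. -/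
def restrictedDyckShift {Γ : Type*} (Ψ : Γ → Finset Γ) : Subshift (DyckSymbol Γ) ℤ :=
  excludeWords (dyckShift Γ)
    {w | ∃ α β : Γ, β ∉ Ψ α ∧ w = [DyckSymbol.plus β, DyckSymbol.plus α]}

end

/-! Reading a word from right to left, closing symbols are pushed on a stack and opening symbols pop
it. The product is nonzero exactly when no pop meets a wrong letter, and every word passing this
test and the restriction `Ψ` extends to a point (`extendWord_mem`), so entropy is the growth rate of
`admissibleWords`.

The number of ways to prepend a symbol depends only on the stack height `h` and on whether the word
starts with a closing symbol: `K` or `N` pushes, and one pop if `h > 0` or `N` if `h = 0`. Functions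
of this state have an explicit transfer operator. It has a positive eigenfunction decaying like `N ^
(-h)`, with eigenvalue `r > N` solving `(r - K / N) * (r - N) = N`; as it is bounded, it gives the
lower bound (`le_card_admissibleWords`). For the upper bound, a function independent of `h` is
nearly superharmonic: it fails only at `h = 0`, by a multiple of the eigenfunction. This costs a
factor linear in `n` (`sum_bounded_function_le`), which vanishes in the limit. -/

namespace RestrictedDyck

open DyckSymbol

/-! ### Nonzero products in the Dyck monoid and the stack action -/

section Words

variable {Γ : Type*}

/-- The closing symbols of a word that are not matched inside the word, from left to right. -/
def unmatchedPlus : List (DyckSymbol Γ) → List Γ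
  | [] => []
  | plus α :: w => α :: unmatchedPlus w
  | minus _ :: w => (unmatchedPlus w).tail

/-- The letters `β` for which `β(+)` may stand in front of a word. -/
def plusChoices [Fintype Γ] (Ψ : Γ → Finset Γ) : List (DyckSymbol Γ) → Finset Γ
  | plus α :: _ => Ψ α
  | _ => Finset.univ

/-- The letters `β` for which `β(-)` may stand in front of a word with a given stack. -/
def minusChoices [Fintype Γ] : List Γ → Finset Γ
  | [] => Finset.univ
  | β :: _ => {β}

/-- The words with nonzero product that respect the restriction `Ψ`, described letter by letter
from right to left. -/
def Admissible [Fintype Γ] (Ψ : Γ → Finset Γ) : List (DyckSymbol Γ) → Prop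
  | [] => True
  | plus α :: w => Admissible Ψ w ∧ α ∈ plusChoices Ψ w
  | minus α :: w => Admissible Ψ w ∧ α ∈ minusChoices (unmatchedPlus w)

theorem Admissible.of_append [Fintype Γ] {Ψ : Γ → Finset Γ} {u v : List (DyckSymbol Γ)}
    (h : Admissible Ψ (u ++ v)) : Admissible Ψ v := by
  induction u with
  | nil => exact h
  | cons s u ih => cases s <;> exact ih h.1

theorem Admissible.mem_of_append [Fintype Γ] {Ψ : Γ → Finset Γ} {u v : List (DyckSymbol Γ)}
    {α β : Γ} (h : Admissible Ψ (u ++ plus β :: plus α :: v)) : β ∈ Ψ α :=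
  h.of_append.2

/-- The product of a word in the Dyck inverse monoid. -/
def product (w : List (DyckSymbol Γ)) : DyckInverseMonoid Γ :=
  (w.map DyckInverseMonoid.of).prod

theorem product_cons (s : DyckSymbol Γ) (w : List (DyckSymbol Γ)) :
    product (s :: w) = DyckInverseMonoid.of s * product w := by
  simp [product]

theorem product_append (u v : List (DyckSymbol Γ)) :
    product (u ++ v) = product u * product v := by
  simp [product]

theorem of_minus_mul_of_plus (γ : Γ) :
    DyckInverseMonoid.of (minus γ) * DyckInverseMonoid.of (plus γ) = 1 := by
  have h : DyckInverseMonoid.mk Γ _ = DyckInverseMonoid.mk Γ 1 :=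
    (Con.eq _).2 (ConGen.Rel.of _ _ (DyckRel.eq_one γ))
  rw [WithZero.coe_mul, map_mul, map_one] at h
  exact h

theorem of_minus_mul_of_plus_of_ne {γ γ' : Γ} (hne : γ ≠ γ') :
    DyckInverseMonoid.of (minus γ) * DyckInverseMonoid.of (plus γ') = 0 := by
  have h : DyckInverseMonoid.mk Γ _ = DyckInverseMonoid.mk Γ 0 :=
    (Con.eq _).2 (ConGen.Rel.of _ _ (DyckRel.eq_zero γ γ' hne))
  rw [WithZero.coe_mul, map_mul] at h
  exact h

/-- A word with nonzero product reduces to its unmatched closing symbols followed by opening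
symbols. -/
theorem exists_product_eq (w : List (DyckSymbol Γ)) (hw : product w ≠ 0) :
    ∃ t : List Γ, product w = product ((unmatchedPlus w).map plus) * product (t.map minus) := by
  induction w with
  | nil => exact ⟨[], by simp [unmatchedPlus, product]⟩
  | cons s w ih =>
    have hw' : product w ≠ 0 := fun h => hw (by rw [product_cons, h, mul_zero])
    obtain ⟨t, ht⟩ := ih hw'
    cases s with
    | plus α =>
      exact ⟨t, by rw [product_cons, ht, unmatchedPlus, List.map_cons, product_cons, mul_assoc]⟩
    | minus α =>
      rw [product_cons, ht] at hw ⊢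
      rw [unmatchedPlus]
      cases hs : unmatchedPlus w with
      | nil => exact ⟨α :: t, by simp [product]⟩
      | cons β s =>
        rw [hs, List.map_cons, product_cons, ← mul_assoc, ← mul_assoc] at hw
        have hαβ : α = β := by
          by_contra hne
          exact hw (by rw [of_minus_mul_of_plus_of_ne hne, zero_mul, zero_mul])
        subst hαβ
        exact ⟨t, by rw [List.map_cons, product_cons, ← mul_assoc, ← mul_assoc,
          of_minus_mul_of_plus, one_mul, List.tail_cons]⟩

theorem mem_minusChoices_of_product_ne_zero [Fintype Γ] {α : Γ} {w : List (DyckSymbol Γ)}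
    (hw : product (minus α :: w) ≠ 0) : α ∈ minusChoices (unmatchedPlus w) := by
  have hw' : product w ≠ 0 := fun h => hw (by rw [product_cons, h, mul_zero])
  obtain ⟨t, ht⟩ := exists_product_eq w hw'
  cases hs : unmatchedPlus w with
  | nil => exact Finset.mem_univ _
  | cons β s =>
    refine Finset.mem_singleton.2 ?_
    by_contra hne
    refine hw ?_
    rw [product_cons, ht, hs, List.map_cons, product_cons, ← mul_assoc, ← mul_assoc,
      of_minus_mul_of_plus_of_ne hne, zero_mul, zero_mul]

open Classical in
/-- The action of a symbol on stacks: a closing symbol is pushed, an opening symbol pops the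
matching one; `none` is the failure state. -/
noncomputable def stackStep : DyckSymbol Γ → Function.End (Option (List Γ))
  | plus α => fun o => o.map (α :: ·)
  | minus α => fun o => o.bind fun
      -- An unmatched opening symbol leaves the empty stack in place: the action forgets such
      -- symbols but still detects mismatches.
      | [] => some []
      | β :: s => if α = β then some s else none

theorem end_mul_apply {α : Type*} (f g : Function.End α) (a : α) : (f * g) a = f (g a) := rfl

/-- Failure is absorbing; this makes sending `0` to the constant `none` multiplicative. -/
theorem lift_stackStep_none (w : FreeMonoid (DyckSymbol Γ)) :
    FreeMonoid.lift stackStep w none = none := by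
  induction w using FreeMonoid.recOn with
  | one => rw [map_one]; rfl
  | of_mul s w h =>
    rw [map_mul, end_mul_apply, h, FreeMonoid.lift_eval_of]
    cases s <;> rfl

/-- The action of the free monoid with zero on stacks. -/
noncomputable def stackHom :
    WithZero (FreeMonoid (DyckSymbol Γ)) →* Function.End (Option (List Γ)) where
  toFun a := WithZero.recZeroCoe (fun _ => none) (fun w => FreeMonoid.lift stackStep w) a
  map_one' := (FreeMonoid.lift stackStep).map_one
  map_mul' a b := by
    induction a using WithZero.recZeroCoe with
    | zero => rw [zero_mul]; rfl
    | coe a =>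
      induction b using WithZero.recZeroCoe with
      | zero =>
        rw [mul_zero]
        funext o
        exact (lift_stackStep_none a).symm
      | coe b => exact (FreeMonoid.lift stackStep).map_mul a b

theorem stackHom_coe (w : FreeMonoid (DyckSymbol Γ)) :
    stackHom (w : WithZero (FreeMonoid (DyckSymbol Γ))) = FreeMonoid.lift stackStep w := rfl

theorem conGen_dyckRel_le_ker : conGen (DyckRel Γ) ≤ Con.ker (stackHom (Γ := Γ)) := by
  rw [Con.conGen_le]
  intro a b h
  rw [Con.ker_rel]
  cases h with
  | eq_one γ =>
    rw [stackHom_coe, map_mul, map_one, FreeMonoid.lift_eval_of, FreeMonoid.lift_eval_of]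
    funext o
    rw [end_mul_apply]
    change _ = o
    cases o <;> simp [stackStep]
  | eq_zero γ γ' hne =>
    rw [stackHom_coe, map_mul, FreeMonoid.lift_eval_of, FreeMonoid.lift_eval_of]
    funext o
    rw [end_mul_apply]
    change _ = none
    cases o <;> simp [stackStep, hne]

/-- The action of the Dyck inverse monoid on stacks. -/
noncomputable def stackAction : DyckInverseMonoid Γ →* Function.End (Option (List Γ)) :=
  (conGen (DyckRel Γ)).lift stackHom conGen_dyckRel_le_ker

theorem stackAction_of (s : DyckSymbol Γ) :
    stackAction (DyckInverseMonoid.of s) = stackStep s :=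
  (Con.lift_mk' conGen_dyckRel_le_ker _).trans (FreeMonoid.lift_eval_of stackStep s)

theorem stackAction_zero (o : Option (List Γ)) :
    stackAction (0 : DyckInverseMonoid Γ) o = none :=
  congrFun (Con.lift_mk' conGen_dyckRel_le_ker (0 : WithZero (FreeMonoid (DyckSymbol Γ)))) o

/-- Admissibility is what keeps each pop from failing. As `0` acts by constant failure, the product
is then nonzero. -/
theorem Admissible.stackAction_product [Fintype Γ] {Ψ : Γ → Finset Γ} {w : List (DyckSymbol Γ)}
    (hw : Admissible Ψ w) : stackAction (product w) (some []) = some (unmatchedPlus w) := by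
  induction w with
  | nil => exact congrFun (map_one stackAction) _
  | cons s w ih =>
    rw [product_cons, map_mul, stackAction_of, end_mul_apply]
    cases s with
    | plus α => rw [ih hw.1]; rfl
    | minus α =>
      rw [ih hw.1, unmatchedPlus]
      have hα := hw.2
      cases hs : unmatchedPlus w with
      | nil => rfl
      | cons β s =>
        rw [hs, minusChoices, Finset.mem_singleton] at hα
        simp [stackStep, hα]

theorem Admissible.product_ne_zero [Fintype Γ] {Ψ : Γ → Finset Γ} {w : List (DyckSymbol Γ)}
    (hw : Admissible Ψ w) : product w ≠ 0 := fun h => by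
  have := hw.stackAction_product
  rw [h, stackAction_zero] at this
  exact Option.some_ne_none _ this.symm

end Words

/-! ### The language of the shift consists of the admissible words -/

section Language

theorem wordAt_succ {A : Type*} (x : ℤ → A) (i : ℤ) (n : ℕ) :
    wordAt x i (n + 1) = x i :: wordAt x (i + 1) n := by
  simp only [wordAt, List.ofFn_succ]
  congr 1
  · simp
  · congr 1
    funext j
    congr 1
    push_cast [Fin.val_succ]
    ring

theorem wordAt_add {A : Type*} (x : ℤ → A) (i : ℤ) (m n : ℕ) :
    wordAt x i (m + n) = wordAt x i m ++ wordAt x (i + m) n := by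
  induction m generalizing i with
  | zero => simp [wordAt]
  | succ m ih =>
    rw [Nat.add_right_comm, wordAt_succ, wordAt_succ, ih, List.cons_append]
    congr 3
    push_cast
    ring

variable {Γ : Type*}

theorem unmatchedPlus_append_minus (w : List (DyckSymbol Γ)) (m : ℕ) (γ : Γ) :
    unmatchedPlus (w ++ List.replicate m (minus γ)) = unmatchedPlus w := by
  induction w with
  | nil =>
    induction m with
    | zero => rfl
    | succ m ih => simpa [List.replicate_succ, unmatchedPlus] using congrArg List.tail ih
  | cons s w ih => cases s <;> simp [unmatchedPlus, ih]

/-- Prepending `k` closing symbols chosen by `c` to a word. -/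
def prependPlus (c : List (DyckSymbol Γ) → Γ) (w : List (DyckSymbol Γ)) :
    ℕ → List (DyckSymbol Γ)
  | 0 => w
  | k + 1 => plus (c (prependPlus c w k)) :: prependPlus c w k

/-- The point that has the word `w` at `0`, closing symbols before it and `γ(-)` after it. -/
def extendWord (c : List (DyckSymbol Γ) → Γ) (γ : Γ) (w : List (DyckSymbol Γ)) :
    ℤ → DyckSymbol Γ
  | Int.ofNat n => w.getD n (minus γ)
  | Int.negSucc k => plus (c (prependPlus c w k))

theorem wordAt_extendWord (c : List (DyckSymbol Γ) → Γ) (γ : Γ) (w : List (DyckSymbol Γ))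
    (k m : ℕ) : wordAt (extendWord c γ w) (-k) (k + (w.length + m)) =
      prependPlus c w k ++ List.replicate m (minus γ) := by
  induction k with
  | zero =>
    rw [prependPlus, Nat.zero_add]
    refine List.ext_getElem (by simp [wordAt]) fun j h1 h2 => ?_
    have : (-((0 : ℕ) : ℤ) + (j : ℤ)) = Int.ofNat j := by simp
    simp only [wordAt, List.getElem_ofFn, this, extendWord]
    by_cases hj : j < w.length
    · simp [hj, List.getElem_append_left]
    · simp [hj, List.getElem_append_right (Nat.le_of_not_lt hj)]
  | succ k ih =>
    have h : (-((k + 1 : ℕ) : ℤ)) = Int.negSucc k := rfl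
    have h' : (-((k + 1 : ℕ) : ℤ)) + 1 = -(k : ℤ) := by push_cast; ring
    rw [Nat.add_right_comm, wordAt_succ, h', ih, h]
    rfl

variable {Ψ : Γ → Finset Γ}

theorem mem_restrictedDyckShift {x : ℤ → DyckSymbol Γ} :
    x ∈ (restrictedDyckShift Ψ).carrier ↔
      (∀ (i : ℤ) (n : ℕ), product (wordAt x i n) ≠ 0) ∧
        ∀ (i : ℤ) (α β : Γ), x i = plus β → x (i + 1) = plus α → β ∈ Ψ α := by
  refine and_congr_right fun _ => ⟨fun h i α β hβ hα => ?_, fun h w hw i hi => ?_⟩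
  · by_contra hn
    refine h _ ⟨α, β, hn, rfl⟩ i ?_
    simp [wordAt, hα, hβ]
  · obtain ⟨α, β, hn, rfl⟩ := hw
    refine hn (h i α β ?_ ?_)
    · simpa [wordAt] using congrArg List.head? hi
    · have := congrArg (fun l => l[1]?) hi
      simpa [wordAt] using this

variable [Fintype Γ]

theorem admissible_wordAt {x : ℤ → DyckSymbol Γ} (hx : x ∈ (restrictedDyckShift Ψ).carrier)
    (i : ℤ) (n : ℕ) : Admissible Ψ (wordAt x i n) := by
  obtain ⟨h1, h2⟩ := mem_restrictedDyckShift.1 hx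
  induction n generalizing i with
  | zero => simp [wordAt, Admissible]
  | succ n ih =>
    have hp := h1 i (n + 1)
    rw [wordAt_succ] at hp ⊢
    cases hs : x i with
    | minus α =>
      rw [hs] at hp
      exact ⟨ih _, mem_minusChoices_of_product_ne_zero hp⟩
    | plus β =>
      refine ⟨ih _, ?_⟩
      cases n with
      | zero => simp [wordAt, plusChoices]
      | succ n =>
        rw [wordAt_succ]
        cases ht : x (i + 1) with
        | minus α => simp [plusChoices]
        | plus α => exact h2 i α β hs ht

theorem plusChoices_append_minus (w : List (DyckSymbol Γ)) (m : ℕ) (γ : Γ) :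
    plusChoices Ψ (w ++ List.replicate m (minus γ)) = plusChoices Ψ w := by
  cases w with
  | nil => cases m <;> simp [List.replicate_succ, plusChoices]
  | cons s w => cases s <;> simp [plusChoices]

theorem Admissible.append_minus {w : List (DyckSymbol Γ)} (hw : Admissible Ψ w) (m : ℕ) (γ : Γ) :
    Admissible Ψ (w ++ List.replicate m (minus γ)) := by
  induction w with
  | nil =>
    induction m with
    | zero => exact hw
    | succ m ih =>
      refine ⟨ih, ?_⟩
      have := unmatchedPlus_append_minus [] m γ
      rw [List.nil_append] at this
      change γ ∈ minusChoices (unmatchedPlus (List.replicate m (minus γ)))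
      rw [this]
      exact Finset.mem_univ _
  | cons s w ih =>
    cases s with
    | plus α => exact ⟨ih hw.1, (plusChoices_append_minus (Ψ := Ψ) w m γ).symm ▸ hw.2⟩
    | minus α => exact ⟨ih hw.1, (unmatchedPlus_append_minus w m γ).symm ▸ hw.2⟩

theorem Admissible.prependPlus_append {w : List (DyckSymbol Γ)} (hw : Admissible Ψ w)
    {c : List (DyckSymbol Γ) → Γ} (hc : ∀ v, c v ∈ plusChoices Ψ v) (γ : Γ) (k m : ℕ) :
    Admissible Ψ (prependPlus c w k ++ List.replicate m (minus γ)) := by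
  induction k with
  | zero => exact hw.append_minus m γ
  | succ k ih => exact ⟨ih, (plusChoices_append_minus (Ψ := Ψ) _ m γ).symm ▸ hc _⟩

/-- Closing symbols on the left only have to respect `Ψ`, and opening symbols on the right never
meet a closing one. Every finite window lies in an admissible word, and both defining conditions
pass to factors. -/
theorem extendWord_mem {w : List (DyckSymbol Γ)} (hw : Admissible Ψ w)
    {c : List (DyckSymbol Γ) → Γ} (hc : ∀ v, c v ∈ plusChoices Ψ v) (γ : Γ) :
    extendWord c γ w ∈ (restrictedDyckShift Ψ).carrier := by
  have key : ∀ (i : ℤ) (n : ℕ), ∃ u v,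
      Admissible Ψ (u ++ wordAt (extendWord c γ w) i n ++ v) := by
    intro i n
    -- The window at `i` is placed `a` letters into a longer word starting at `-k`, far enough left
    -- to cover `w` and the whole window.
    obtain ⟨k, a, ha⟩ : ∃ k a : ℕ, i = -(k : ℤ) + a :=
      ⟨(-i).toNat, i.toNat, by omega⟩
    have h := hw.prependPlus_append hc γ k (a + n)
    rw [← wordAt_extendWord] at h
    have e : k + (w.length + (a + n)) = a + n + (k + w.length) := by omega
    rw [e, wordAt_add, wordAt_add, ← ha] at h
    exact ⟨_, _, h⟩
  refine mem_restrictedDyckShift.2 ⟨fun i n h0 => ?_, fun i α β hβ hα => ?_⟩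
  · obtain ⟨u, v, h⟩ := key i n
    refine h.product_ne_zero ?_
    rw [product_append, product_append, h0, mul_zero, zero_mul]
  · obtain ⟨u, v, h⟩ := key i 2
    rw [wordAt_succ, wordAt_succ, hβ, hα, List.append_assoc] at h
    exact h.mem_of_append

theorem mem_languageOfLength (hΨ : ∀ γ, (Ψ γ).Nonempty) [Nonempty Γ] {n : ℕ}
    {w : List (DyckSymbol Γ)} :
    w ∈ languageOfLength (restrictedDyckShift Ψ) n ↔ w.length = n ∧ Admissible Ψ w := by
  constructor
  · rintro ⟨x, hx, i, rfl⟩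
    exact ⟨by simp [wordAt], admissible_wordAt hx i n⟩
  · rintro ⟨rfl, hw⟩
    have hne : ∀ v : List (DyckSymbol Γ), (plusChoices Ψ v).Nonempty := by
      intro v
      unfold plusChoices
      split
      · exact hΨ _
      · exact Finset.univ_nonempty
    choose c hc using hne
    obtain ⟨γ⟩ := ‹Nonempty Γ›
    refine ⟨_, extendWord_mem hw hc γ, 0, ?_⟩
    simpa [prependPlus] using wordAt_extendWord c γ w 0 0

end Language

/-! ### Transfer operator and bounds on the number of admissible words -/

section Counting

variable {Γ : Type*}

/-- The value at a word of a function of its number of unmatched closing symbols that is `a` if the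
word starts with a closing symbol and `b` otherwise. -/
def stateValue (a b : ℕ → ℝ) : List (DyckSymbol Γ) → ℝ
  | plus α :: w => a (unmatchedPlus (plus α :: w)).length
  | w => b (unmatchedPlus w).length

theorem stateValue_mono {a b a' b' : ℕ → ℝ} (w : List (DyckSymbol Γ))
    (ha : ∀ h, a (h + 1) ≤ a' (h + 1)) (hb : ∀ h, b h ≤ b' h) :
    stateValue a b w ≤ stateValue a' b' w := by
  unfold stateValue
  split
  · exact ha _
  · exact hb _

theorem stateValue_congr {a b a' b' : ℕ → ℝ} (w : List (DyckSymbol Γ))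
    (ha : ∀ h, a (h + 1) = a' (h + 1)) (hb : ∀ h, b h = b' h) :
    stateValue a b w = stateValue a' b' w :=
  le_antisymm (stateValue_mono w (fun h => (ha h).le) fun h => (hb h).le)
    (stateValue_mono w (fun h => (ha h).ge) fun h => (hb h).ge)

theorem stateValue_add (a b a' b' : ℕ → ℝ) (w : List (DyckSymbol Γ)) :
    stateValue (fun h => a h + a' h) (fun h => b h + b' h) w =
      stateValue a b w + stateValue a' b' w := by
  unfold stateValue
  split <;> rfl

theorem stateValue_mul (c : ℝ) (a b : ℕ → ℝ) (w : List (DyckSymbol Γ)) :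
    stateValue (fun h => c * a h) (fun h => c * b h) w = c * stateValue a b w := by
  unfold stateValue
  split <;> rfl

theorem stateValue_const (c : ℝ) (w : List (DyckSymbol Γ)) :
    stateValue (fun _ => c) (fun _ => c) w = c := by
  unfold stateValue
  split <;> rfl

variable [Fintype Γ]

open Classical in
/-- The admissible words that extend a word by one symbol in front. -/
noncomputable def extensions (Ψ : Γ → Finset Γ) (w : List (DyckSymbol Γ)) :
    Finset (List (DyckSymbol Γ)) :=
  (plusChoices Ψ w).image (fun α => plus α :: w) ∪
    (minusChoices (unmatchedPlus w)).image (fun α => minus α :: w)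

open Classical in
/-- The finite set of admissible words of length `n`. -/
noncomputable def admissibleWords (Ψ : Γ → Finset Γ) : ℕ → Finset (List (DyckSymbol Γ))
  | 0 => {[]}
  | n + 1 => (admissibleWords Ψ n).biUnion (extensions Ψ)

theorem mem_admissibleWords {Ψ : Γ → Finset Γ} {n : ℕ} {w : List (DyckSymbol Γ)} :
    w ∈ admissibleWords Ψ n ↔ w.length = n ∧ Admissible Ψ w := by
  induction n generalizing w with
  | zero =>
    rw [admissibleWords, Finset.mem_singleton, List.length_eq_zero_iff]
    exact ⟨fun h => ⟨h, h ▸ trivial⟩, And.left⟩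
  | succ n ih =>
    simp only [admissibleWords, extensions, Finset.mem_biUnion, Finset.mem_union,
      Finset.mem_image, ih]
    constructor
    · rintro ⟨v, ⟨rfl, hv⟩, ⟨α, hα, rfl⟩ | ⟨α, hα, rfl⟩⟩
      · exact ⟨rfl, hv, hα⟩
      · exact ⟨rfl, hv, hα⟩
    · rintro ⟨hl, hw⟩
      cases w with
      | nil => simp at hl
      | cons s v =>
        have hl' : v.length = n := Nat.succ_injective hl
        cases s with
        | plus α => exact ⟨v, ⟨hl', hw.1⟩, Or.inl ⟨α, hw.2, rfl⟩⟩
        | minus α => exact ⟨v, ⟨hl', hw.1⟩, Or.inr ⟨α, hw.2, rfl⟩⟩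

theorem sum_extensions (Ψ : Γ → Finset Γ) (w : List (DyckSymbol Γ)) (a b : ℕ → ℝ) :
    ∑ v ∈ extensions Ψ w, stateValue a b v =
      (plusChoices Ψ w).card * a ((unmatchedPlus w).length + 1) +
        (minusChoices (unmatchedPlus w)).card * b ((unmatchedPlus w).length - 1) := by
  classical
  rw [extensions, Finset.sum_union, Finset.sum_image, Finset.sum_image]
  · simp [stateValue, unmatchedPlus]
  · intro α _ β _ h
    simpa using h
  · intro α _ β _ h
    simpa using h
  · rw [Finset.disjoint_left]
    intro v hv hv'
    obtain ⟨α, -, rfl⟩ := Finset.mem_image.1 hv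
    obtain ⟨β, -, h⟩ := Finset.mem_image.1 hv'
    simp at h

theorem sum_admissibleWords_succ (Ψ : Γ → Finset Γ) (n : ℕ) (f : List (DyckSymbol Γ) → ℝ) :
    ∑ v ∈ admissibleWords Ψ (n + 1), f v =
      ∑ w ∈ admissibleWords Ψ n, ∑ v ∈ extensions Ψ w, f v := by
  classical
  rw [admissibleWords, Finset.sum_biUnion]
  intro w _ w' _ hne
  refine Finset.disjoint_left.2 fun v hv hv' => hne ?_
  have tail_eq : ∀ u, v ∈ extensions Ψ u → v.tail = u := by
    intro u hu
    rcases Finset.mem_union.1 hu with h | h <;>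
    · obtain ⟨α, -, rfl⟩ := Finset.mem_image.1 h
      rfl
  rw [← tail_eq w hv, tail_eq w' hv']

variable {Ψ : Γ → Finset Γ} {N K : ℕ}

/-- The sum over the admissible one-symbol extensions of a word, as a function of the state of the
word. -/
theorem sum_extensions_eq_stateValue (hN : Fintype.card Γ = N) (hΨ : ∀ γ, (Ψ γ).card = K)
    (a b : ℕ → ℝ) (w : List (DyckSymbol Γ)) :
    ∑ v ∈ extensions Ψ w, stateValue a b v =
      stateValue (fun h => K * a (h + 1) + b (h - 1))
        (fun h => N * a (h + 1) + (if h = 0 then (N : ℝ) else 1) * b (h - 1)) w := by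
  have hc : ((minusChoices (unmatchedPlus w)).card : ℝ) =
      if (unmatchedPlus w).length = 0 then (N : ℝ) else 1 := by
    cases unmatchedPlus w <;> simp [minusChoices, hN]
  rw [sum_extensions, hc]
  match w with
  | [] => simp [stateValue, plusChoices, unmatchedPlus, hN]
  | minus α :: w => simp only [stateValue, plusChoices, Finset.card_univ, hN]
  | plus α :: w => simp [stateValue, plusChoices, unmatchedPlus, hΨ]

/-- The sum over all admissible words of length `n` of the eigenfunction of the transfer operator
that decays like `N ^ (-h)` in the number `h` of unmatched closing symbols. -/
theorem sum_eigenfunction (hN : Fintype.card Γ = N) (hN0 : 0 < N) (hΨ : ∀ γ, (Ψ γ).card = K)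
    {r : ℝ} (hr : (r - K / N) * (r - N) = N) (n : ℕ) :
    ∑ w ∈ admissibleWords Ψ n,
      stateValue (fun h => (r - N) * ((N : ℝ)⁻¹) ^ h) (fun h => ((N : ℝ)⁻¹) ^ h) w = r ^ n := by
  have hN' : (N : ℝ) ≠ 0 := by positivity
  induction n with
  | zero => simp [admissibleWords, stateValue, unmatchedPlus]
  | succ n ih =>
    rw [sum_admissibleWords_succ, pow_succ', ← ih, Finset.mul_sum]
    refine Finset.sum_congr rfl fun w _ => ?_
    rw [sum_extensions_eq_stateValue hN hΨ, ← stateValue_mul]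
    refine stateValue_congr w (fun h => ?_) fun h => ?_
    · have hr' : r * (r - N) = K / N * (r - N) + N := by linear_combination hr
      rw [← mul_assoc r, hr', Nat.add_sub_cancel, pow_succ, pow_succ]
      field_simp
    · cases h with
      -- At `h = 0` the height `h - 1` truncates to `0`; the `N` possible pops supply the factor `N`
      -- that `N ^ (-h)` would gain at height `-1`. This forces the decay rate.
      | zero => simp; field_simp; ring
      | succ h =>
        simp only [Nat.succ_ne_zero, if_false, Nat.add_sub_cancel, pow_succ]
        field_simp
        ring

/-- The transfer operator increases the function with values `1` and `r - K` at most by the factor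
`r`, up to a multiple of the eigenfunction. -/
theorem sum_bounded_function_le (hN : Fintype.card Γ = N) (hN0 : 0 < N) (hK : K ≤ N)
    (hΨ : ∀ γ, (Ψ γ).card = K) {r : ℝ} (hr : (r - K / N) * (r - N) = N) (hrN : N < r) (n : ℕ) :
    ∑ w ∈ admissibleWords Ψ n, stateValue (fun _ => 1) (fun _ => r - K) w ≤
      ((r - K) * (N * n + 1)) * r ^ n := by
  have hN' : (0 : ℝ) < N := by positivity
  have hN1 : (1 : ℝ) ≤ N := by exact_mod_cast hN0
  have hK' : (K : ℝ) ≤ N := by exact_mod_cast hK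
  induction n with
  | zero => simp [admissibleWords, stateValue]
  | succ n ih =>
    have hstep : ∀ w : List (DyckSymbol Γ),
        ∑ v ∈ extensions Ψ w, stateValue (fun _ => 1) (fun _ => r - K) v ≤
          r * stateValue (fun _ => 1) (fun _ => r - K) w + (r - K) * N *
            stateValue (fun h => (r - N) * ((N : ℝ)⁻¹) ^ h) (fun h => ((N : ℝ)⁻¹) ^ h) w := by
      intro w
      rw [sum_extensions_eq_stateValue hN hΨ, ← stateValue_mul, ← stateValue_mul,
        ← stateValue_add]
      -- By the equation for `r`, the difference of the two sides is `(N - K) * (1 - 1 / N) * r`.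
      have hf : N + (r - K) ≤ r * (r - K) := by
        have h1 : (r - K / N) * (r - N) = r * r - r * N - K / N * r + K := by
          field_simp
          ring
        have h2 : 0 ≤ (N - K) * (1 - (N : ℝ)⁻¹) * r :=
          mul_nonneg (mul_nonneg (by linarith) (by simpa using inv_le_one_of_one_le₀ hN1))
            (by linarith)
        have h3 : (N - K) * (1 - (N : ℝ)⁻¹) * r = (N - 1 - K + K / N) * r := by
          field_simp
          ring
        linarith
      refine stateValue_mono w (fun h => ?_) fun h => ?_
      -- Here `K + (r - K) = r` exactly, whence the value `r - K`; the eigenfunction term is only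
      -- spare.
      · have : 0 ≤ (r - K) * N * ((r - N) * (N : ℝ)⁻¹ ^ (h + 1)) := by
          have : 0 ≤ r - K := by linarith
          have : 0 ≤ r - N := by linarith
          positivity
        linarith
      · cases h with
        -- Only here is the correction needed: the `N` pops exceed the single one in `hf` by `(N -
        -- 1) * (r - K)`, and the eigenfunction equals `1`.
        | zero => simp; linarith
        | succ h =>
          have : 0 ≤ (r - K) * N * ((N : ℝ)⁻¹ ^ (h + 1)) := by
            have : 0 ≤ r - K := by linarith
            positivity
          simp only [Nat.succ_ne_zero, if_false]
          linarith
    rw [sum_admissibleWords_succ]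
    refine (Finset.sum_le_sum fun w _ => hstep w).trans ?_
    rw [Finset.sum_add_distrib, ← Finset.mul_sum, ← Finset.mul_sum,
      sum_eigenfunction hN hN0 hΨ hr]
    have hr0 : 0 ≤ r := by linarith
    have h1 := mul_le_mul_of_nonneg_left ih hr0
    have h2 : (r - K) * N * r ^ n ≤ (r - K) * N * r ^ (n + 1) := by
      have : 0 ≤ r - K := by linarith
      have : r ^ n ≤ r ^ (n + 1) := pow_le_pow_right₀ (by linarith) n.le_succ
      gcongr
    push_cast
    rw [pow_succ] at h2 ⊢
    linarith

theorem card_admissibleWords_le (hN : Fintype.card Γ = N) (hK : K < N)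
    (hΨ : ∀ γ, (Ψ γ).card = K) {r : ℝ} (hr : (r - K / N) * (r - N) = N) (hrN : N < r) (n : ℕ) :
    ((admissibleWords Ψ n).card : ℝ) ≤ ((r - K) * N * (n + 1)) * r ^ n := by
  have hN0 : 0 < N := by omega
  have hN1 : (1 : ℝ) ≤ N := by exact_mod_cast hN0
  have hK' : (K : ℝ) + 1 ≤ N := by exact_mod_cast hK
  have h := sum_bounded_function_le hN hN0 hK.le hΨ hr hrN n
  have h1 : ((admissibleWords Ψ n).card : ℝ) ≤
      ∑ w ∈ admissibleWords Ψ n, stateValue (fun _ => 1) (fun _ => r - K) w := by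
    rw [Finset.card_eq_sum_ones, Nat.cast_sum]
    refine Finset.sum_le_sum fun w _ => ?_
    refine (le_of_eq ?_).trans (stateValue_mono (a := fun _ => 1) (b := fun _ => 1) w (fun _ => le_rfl)
      fun _ => by linarith)
    rw [Nat.cast_one, stateValue_const]
  refine (h1.trans h).trans (mul_le_mul_of_nonneg_right ?_ (pow_nonneg (by linarith) n))
  have : 0 ≤ r - K := by linarith
  nlinarith

/-- The eigenfunction sums to `r ^ n` and is at most `r - N + 1`, a common bound for its two
branches. -/
theorem le_card_admissibleWords (hN : Fintype.card Γ = N) (hN0 : 0 < N)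
    (hΨ : ∀ γ, (Ψ γ).card = K) {r : ℝ} (hr : (r - K / N) * (r - N) = N) (hrN : N < r) (n : ℕ) :
    r ^ n ≤ (r - N + 1) * (admissibleWords Ψ n).card := by
  have hN1 : (N : ℝ)⁻¹ ≤ 1 := inv_le_one_of_one_le₀ (by exact_mod_cast hN0)
  have hN2 : 0 ≤ (N : ℝ)⁻¹ := by positivity
  rw [← sum_eigenfunction hN hN0 hΨ hr n, mul_comm, ← nsmul_eq_mul]
  refine Finset.sum_le_card_nsmul _ _ _ fun w _ => ?_
  rw [← stateValue_const (r - N + 1) w]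
  refine stateValue_mono w (fun h => ?_) fun h => ?_
  · have := mul_le_of_le_one_right (sub_nonneg.2 hrN.le) (pow_le_one₀ hN2 hN1 (n := h + 1))
    linarith
  · have := pow_le_one₀ hN2 hN1 (n := h)
    linarith

end Counting

/-! ### From counting bounds to entropy -/

/-- A sequence between constant and linear multiples of `r ^ n` has exponential growth rate
`log r`. -/
theorem tendsto_log_div_of_bounds {u : ℕ → ℝ} {r c C : ℝ} (hr : 0 < r) (hc : 0 < c) (hC : 0 < C)
    (hl : ∀ n, r ^ n ≤ c * u n) (hu : ∀ n : ℕ, u n ≤ C * (n + 1) * r ^ n) :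
    Tendsto (fun n : ℕ => 1 / (n : ℝ) * Real.log (u n)) atTop (𝓝 (Real.log r)) := by
  have hinv : Tendsto (fun n : ℕ => 1 / (n : ℝ)) atTop (𝓝 0) := tendsto_one_div_atTop_nhds_zero_nat
  have hlog : Tendsto (fun n : ℕ => 1 / (n : ℝ) * Real.log ((n : ℝ) + 1)) atTop (𝓝 0) := by
    have h1 : Tendsto (fun n : ℕ => Real.log ((n : ℝ) + 1) / (1 * ((n : ℝ) + 1) + -1)) atTop (𝓝 0) :=
      (Real.tendsto_pow_log_div_mul_add_atTop 1 (-1) 1 one_ne_zero).comp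
        (tendsto_atTop_add_const_right _ (1 : ℝ) tendsto_natCast_atTop_atTop) |>.congr
        fun n => by simp
    refine h1.congr fun n => ?_
    ring_nf
  have hpos : ∀ n, 0 < u n := fun n => by
    have : 0 < c * u n := (pow_pos hr n).trans_le (hl n)
    exact (mul_pos_iff_of_pos_left hc).1 this
  have hlow : Tendsto (fun n : ℕ => Real.log r - 1 / (n : ℝ) * Real.log c) atTop
      (𝓝 (Real.log r)) := by
    simpa using tendsto_const_nhds.sub (hinv.mul_const (Real.log c))
  have hupp : Tendsto (fun n : ℕ => Real.log r + (1 / (n : ℝ) * Real.log C +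
      1 / (n : ℝ) * Real.log ((n : ℝ) + 1))) atTop (𝓝 (Real.log r)) := by
    simpa using tendsto_const_nhds.add ((hinv.mul_const (Real.log C)).add hlog)
  refine tendsto_of_tendsto_of_tendsto_of_le_of_le' hlow hupp ?_ ?_
  · filter_upwards [eventually_gt_atTop 0] with n hn
    have hn' : (0 : ℝ) < n := by exact_mod_cast hn
    have h := Real.log_le_log (pow_pos hr n) (hl n)
    rw [Real.log_pow, Real.log_mul hc.ne' (hpos n).ne'] at h
    have : Real.log r = 1 / (n : ℝ) * (n * Real.log r) := by field_simp
    rw [this, ← mul_sub]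
    gcongr
    linarith
  · filter_upwards [eventually_gt_atTop 0] with n hn
    have hn' : (0 : ℝ) < n := by exact_mod_cast hn
    have h := Real.log_le_log (hpos n) (hu n)
    rw [Real.log_mul (by positivity) (by positivity), Real.log_mul (by positivity) (by positivity),
      Real.log_pow] at h
    have : Real.log r = 1 / (n : ℝ) * (n * Real.log r) := by field_simp
    rw [this, ← mul_add, ← mul_add]
    gcongr
    linarith

end RestrictedDyck

open RestrictedDyck in
theorem corollary4p10 {Γ : Type*} [Fintype Γ] [Nontrivial Γ] (Ψ : Γ → Finset Γ) (N K : ℕ)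
    (hN : Fintype.card Γ = N) (hK : 1 ≤ K) (hKN : K < N) (hΨ : ∀ γ : Γ, (Ψ γ).card = K) :
    HasTopologicalEntropy (restrictedDyckShift Ψ)
      (Real.log N + Real.log ((N : ℝ) - K) + Real.log 2
        - Real.log (√(((N : ℝ) ^ 2 + K) ^ 2 + 4 * ((N : ℝ) - K) * (N : ℝ) ^ 2)
            - (N : ℝ) ^ 2 - K)) := by
  have hKN' : (0 : ℝ) < N - K := sub_pos.2 (by exact_mod_cast hKN)
  have hN0 : (0 : ℝ) < N := by exact_mod_cast hK.trans_lt hKN |>.le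
  have hK0 : (0 : ℝ) < K := by exact_mod_cast hK
  set S := √(((N : ℝ) ^ 2 + K) ^ 2 + 4 * ((N : ℝ) - K) * (N : ℝ) ^ 2) with hS
  have hSS : S ^ 2 = ((N : ℝ) ^ 2 + K) ^ 2 + 4 * ((N : ℝ) - K) * (N : ℝ) ^ 2 :=
    Real.sq_sqrt (by positivity)
  have hSq : (N : ℝ) ^ 2 + K < S := Real.lt_sqrt_of_sq_lt (by
    have : 0 < 4 * ((N : ℝ) - K) * (N : ℝ) ^ 2 := by positivity
    linarith)
  -- The larger root of the eigenvalue equation; rationalising it with `hSS` gives the stated form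
  -- of the entropy.
  set r : ℝ := ((N : ℝ) ^ 2 + K + S) / (2 * N) with hr_def
  have hr : (r - K / N) * (r - N) = N := by
    rw [hr_def]
    field_simp
    linear_combination hSS
  have hrN : N < r := by
    rw [hr_def, lt_div_iff₀ (by positivity)]
    linarith
  have hlim : Real.log N + Real.log ((N : ℝ) - K) + Real.log 2 - Real.log (S - (N : ℝ) ^ 2 - K) =
      Real.log r := by
    have hd : 0 < S - (N : ℝ) ^ 2 - K := by linarith
    rw [← Real.log_mul hN0.ne' hKN'.ne', ← Real.log_mul (by positivity) two_ne_zero,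
      ← Real.log_div (by positivity) hd.ne', hr_def]
    congr 1
    rw [div_eq_div_iff hd.ne' (by positivity)]
    linear_combination -hSS
  rw [hlim, HasTopologicalEntropy]
  have hcard : ∀ n, (languageOfLength (restrictedDyckShift Ψ) n).ncard =
      (admissibleWords Ψ n).card := fun n => by
    rw [← Set.ncard_coe_finset]
    congr 1
    ext w
    rw [mem_languageOfLength fun γ => Finset.card_pos.1 (by rw [hΨ γ]; exact hK), Finset.mem_coe,
      mem_admissibleWords]
  simp only [hcard]
  exact tendsto_log_div_of_bounds (hN0.trans hrN) (by linarith) (mul_pos (by linarith) hN0)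
    (le_card_admissibleWords hN (by omega) hΨ hr hrN) (card_admissibleWords_le hN hKN hΨ hr hrN)
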